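/- **Setting.** Let $\mathcal L=\{<,\dots\}$ be a countable first-order language, $\theta$ a strongly inaccessible (in particular uncountable) cardinal. Let $\mathcal L^S$ be the Skolem language of $\mathcal L$ (add, $\omega$ times, a Skolem function symbol for every formula with a distinguished variable), and let $M$ be an $\mathcal L^S$-structure satisfying the Skolem theory $T_{\mathrm{skolem}}$, in which $<$ is a linear order that is $\theta$-like: $|M|=\theta$ and every proper initial segment has cardinality $<\theta$. Let $M=\bigcup_{i<\theta}M_i$, where $\langle M_i\rangle_{i<\theta}$ is a continuous chain of elementary $\mathcal L^S$-submodels of $M$ such that $M_j$ is an end extension of $M_i$ for $i<j<\theta$, and put $F(a)=\min\{i<\theta: a\in M_i\}$ for $a\in M$. Let $r,s$ be positive integers. For a set $X\subset M$, $[X]^r$ is the set of strictly increasing $r$-sequences from $X$ and, for a cardinal $\mu$, $[X]^\mu$ is the set of subsets of $X$ of cardinality $\mu$. $[F]^{r,s}$ is the set of all $\mathbf a=\langle\langle a_{11},\dots,a_{1r}\rangle,\dots,\langle a_{s1},\dots,a_{sr}\rangle\rangle$ whose rows are in $[M]^r$, with $F(a_{ij})=F(a_{il})$ for all $i,j,l$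 and $F(a_{11})<F(a_{21})<\dots<F(a_{s1})$. For $A\subset M$, $[F|A]^{r,s}$ is the set of those $\mathbf a\in[F]^{r,s}$ with all entries in $A$; $[F|A]^{r,0}$ consists of the empty tuple only. **Superlarge sets.** Let $1\le e\le s$ and $S\subset[F]^{r,s}$. In the game $G(S,e)$ player I chooses a cardinal $\mu_1<\theta$, player II an ordinal $\beta_1<\theta$, then I chooses $\mu_2<\theta$, II chooses $\beta_2<\theta$, and so on; after I's $e$-th move $\mu_e<\theta$, II's $e$-th and last move is a sequence $\langle\beta_{e+i}\rangle_{i<\theta}$ of ordinals $<\theta$. Player II wins if $\beta_1<\beta_2<\dots<\beta_e<\dots<\beta_{e+i}<\cdots$ $(i<\theta)$ and there are sets $X_k\in[F^{-1}(\beta_k)]^{\mu_k}$ $(1\le k\le e)$ and $X_{e+i}\subset F^{-1}(\beta_{e+i})$ $(1\le i<\theta)$ with $\sup\{|X_{e+i}|:1\le i<\theta\}=\theta$ and $$\prod_{1\le k\le e}[X_k]^r\times\Big[F\,\Big|\bigcup_{1\le i<\theta}X_{e+i}\Big]^{r,s-e}\subset S .$$ $S$ is *$e$-superlarge* if II has a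 winning strategy in $G(S,e)$. **Sentences.** Let $C^*=\{c_{ij}: i,j<\omega\}$ be new constants, ordered lexicographically by their indices. A sentence $\sigma$ of $\mathcal L^S(C^*)$ is *of type $\Sigma_1^*$(iv)*, with $\iota(\sigma)=i_n$, if it has the form $$\tau(c_{i_1j_1},\dots,c_{i_nj_n})<c_{(i_n-1)j}\ \longrightarrow\ \tau(c_{i_1j_1},\dots,c_{i_nj_n})=\tau(c_{i_1j_1},\dots,c_{i_qj_q},c_{ul_1},\dots,c_{ul_{n-q}}),$$ where $n\ge1$, $\tau(v_1,\dots,v_n)$ is a term of $\mathcal L^S$, $i_n>1$, $u\ge i_n$, $q$ is the greatest index with $i_q\ne i_n$ ($q=0$ if there is none), and both displayed sequences of constants, $c_{i_1j_1},\dots,c_{i_nj_n}$ and $c_{i_1j_1},\dots,c_{i_qj_q},c_{ul_1},\dots,c_{ul_{n-q}}$, are strictly increasing. If all $c_{ij}$ occurring in $\sigma$ have $1\le i\le s$, $1\le j\le r$, and $\mathbf a\in[F]^{r,s}$, then $M\models\sigma(\mathbf a)$ means that $\sigma$ holds in $M$ with each $c_{ij}$ interpreted as $a_{ij}$. **Proposition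 3.4.** Let $S\subset[F]^{r,s}$ be $e$-superlarge, $1\le e<s$. Let $\sigma_1,\dots,\sigma_p$ be finitely many sentences of type $\Sigma_1^*$(iv) such that all $c_{ij}$ occurring in them satisfy $1\le i\le s$ and $1\le j\le r$, and such that $\iota(\sigma_1)=\dots=\iota(\sigma_p)=e'$ with $e<e'\le s$. Then there is an $e'$-superlarge set $S'\subset S$ such that $M\models\sigma_1(\mathbf a)\wedge\dots\wedge\sigma_p(\mathbf a)$ for every $\mathbf a\in S'$. -/

import Mathlib

open Cardinal Ordinal Order

universe u w

namespace Superlarge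

/-! ### The Skolem language and the Skolem theory -/

/-- Finite stages of the Skolemization of `L`: stage `0` is `L`, and stage `k + 1` adds to stage `k`
an `n`-ary function symbol for every formula `φ(x₀, …, xₙ₋₁, y)` of stage `k`. -/
def skolemStage (L : FirstOrder.Language.{u, u}) : ℕ → FirstOrder.Language.{u, u}
  | 0 => L
  | k + 1 => (skolemStage L k).sum (skolemStage L k).skolem₁

/-- The Skolem language `L^S` of `L`, the union of all stages: its function symbols are those of `L`
together with one Skolem function symbol for every formula of every stage; its relation symbols are
those of `L`. -/
def skolemLanguage (L : FirstOrder.Language.{u, u}) : FirstOrder.Language.{u, u} where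
  Functions n := L.Functions n ⊕ Σ k : ℕ, (skolemStage L k).BoundedFormula Empty (n + 1)
  Relations n := L.Relations n

/-- A relation symbol of `L` as a relation symbol of `L^S`. -/
def relSymbol (L : FirstOrder.Language.{u, u}) {n : ℕ} (R : L.Relations n) :
    (skolemLanguage L).Relations n := R

/-- The inclusion of the `k`-th stage in `L^S`. -/
def stageHom (L : FirstOrder.Language.{u, u}) : ∀ k : ℕ, skolemStage L k →ᴸ skolemLanguage L
  | 0 => ⟨fun _ f => Sum.inl f, fun _ R => R⟩
  | k + 1 => (stageHom L k).sumElim ⟨fun _ φ => Sum.inr ⟨k, φ⟩, fun _ R => R.elim⟩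

/-- The Skolem function symbol of the formula `φ(x₀, …, xₙ₋₁, y)`. -/
def skolemSymbol (L : FirstOrder.Language.{u, u}) {k n : ℕ}
    (φ : (skolemStage L k).BoundedFormula Empty (n + 1)) : (skolemLanguage L).Functions n :=
  Sum.inr ⟨k, φ⟩

/-- The Skolem axiom `∀ x̄ (∃ y φ(x̄, y) → ∃ y (φ(x̄, y) ∧ f_φ(x̄) = y))` of `φ(x̄, y)`. -/
def skolemAxiom (L : FirstOrder.Language.{u, u}) {k n : ℕ}
    (φ : (skolemStage L k).BoundedFormula Empty (n + 1)) : (skolemLanguage L).Sentence :=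
  ((((stageHom L k).onBoundedFormula φ).ex).imp
    (((stageHom L k).onBoundedFormula φ ⊓
      (FirstOrder.Language.Term.func (skolemSymbol L φ)
          (fun i : Fin n => FirstOrder.Language.Term.var (Sum.inr i.castSucc))).bdEqual
        (FirstOrder.Language.Term.var (Sum.inr (Fin.last n)))).ex)).alls

/-- The theory `T_skolem`. -/
def skolemTheory (L : FirstOrder.Language.{u, u}) : (skolemLanguage L).Theory :=
  {ψ | ∃ (k n : ℕ) (φ : (skolemStage L k).BoundedFormula Empty (n + 1)), ψ = skolemAxiom L φ}

/-! ### Sentences of type (iv) of the theory `Σ₁*` -/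

/-- A sentence of `L^S(C*)`, where `C* = {c_{ij} | i, j < ω}`; the constant `c_{ij}` is indexed by
the pair `(i, j)`. -/
abbrev CSentence (L : FirstOrder.Language.{u, u}) := ((skolemLanguage L).withConstants (ℕ × ℕ)).Sentence

/-- The (indices of the) constants `c_{ij}` occurring in a sentence of `L^S(C*)`: these are the
free variables after each constant has been turned into a variable. -/
def constantsIn {L : FirstOrder.Language.{u, u}} (σ : CSentence L) : Finset (ℕ × ℕ) :=
  (FirstOrder.Language.Formula.equivSentence.symm σ).freeVarFinset

/-- The data of a sentence of type (iv): a term `τ(v_1, …, v_n)` of `L^S` with `n ≥ 1` (here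
`n = m + 1`, and `v_1, …, v_n` are numbered from `0` to `m`), an increasing sequence of constants
`c_{i_1 j_1}, …, c_{i_n j_n}` with `i_n > 1`, an index `j`, an index `u ≥ i_n` and indices for the
new constants `c_{u l}`. -/
structure TypeIVData (L : FirstOrder.Language.{u, u}) where
  m : ℕ
  τ : (skolemLanguage L).Term (Fin (m + 1))
  /-- `c k = (i_k, j_k)` -/
  c : Fin (m + 1) → ℕ × ℕ
  j : ℕ
  u : ℕ
  /-- only the values at those `k` with `i_k = i_n` matter -/
  l : Fin (m + 1) → ℕ
  c_increasing : StrictMono fun k => toLex (c k)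
  one_lt : 1 < (c (Fin.last m)).1
  le_u : (c (Fin.last m)).1 ≤ u
  right_increasing :
    StrictMono fun k => toLex (if (c k).1 = (c (Fin.last m)).1 then (u, l k) else c k)

namespace TypeIVData

variable {L : FirstOrder.Language.{u, u}} (d : TypeIVData L)

/-- `ι = i_n` -/
def iota : ℕ := (d.c (Fin.last d.m)).1

/-- The constants on the right-hand side: `c_{i_k j_k}` is kept if `i_k ≠ i_n`, and replaced by
`c_{u l_k}` if `i_k = i_n`. -/
def right (k : Fin (d.m + 1)) : ℕ × ℕ := if (d.c k).1 = d.iota then (d.u, d.l k) else d.c k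

/-- The sentence `τ(c_{i_1 j_1}, …, c_{i_n j_n}) < c_{(i_n - 1) j} →
τ(c_{i_1 j_1}, …, c_{i_n j_n}) = τ(c̄, c_{u l_1}, …, c_{u l_{n - q}})`. -/
def sentence (lt : L.Relations 2) : CSentence L :=
  FirstOrder.Language.Formula.equivSentence
    (((relSymbol L lt).formula₂
        (d.τ.relabel d.c) (FirstOrder.Language.Term.var (d.iota - 1, d.j))).imp
      (FirstOrder.Language.Term.equal (d.τ.relabel d.c) (d.τ.relabel d.right)))

end TypeIVData

/-- `σ` is a sentence of type `Σ₁*`(iv) with `ι(σ) = e`. (`ι` is a function of `σ`, as the constant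
on the right of `<` in `σ` is `c_{(ι(σ) - 1) j}`.) -/
def IsTypeIV {L : FirstOrder.Language.{u, u}} (lt : L.Relations 2) (σ : CSentence L) (e : ℕ) : Prop :=
  ∃ d : TypeIVData L, d.sentence lt = σ ∧ d.iota = e

/-- `M ⊨ σ(𝐚)` for an `s × r` matrix `𝐚`: the sentence `σ` holds in `M` when every `c_{ij}` with
`1 ≤ i ≤ s`, `1 ≤ j ≤ r` is interpreted as `a_{ij}` (matrices are indexed from `0` here), no matter
how the other constants are interpreted. -/
def SatisfiesAt {L : FirstOrder.Language.{u, u}} {M : Type w} [(skolemLanguage L).Structure M] {r s : ℕ}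
    (σ : CSentence L) (a : Fin s → Fin r → M) : Prop :=
  ∀ v : ℕ × ℕ → M, (∀ (i : Fin s) (j : Fin r), v (i + 1, j + 1) = a i j) →
    letI := FirstOrder.Language.constantsOn.structure v
    FirstOrder.Language.Sentence.Realize M σ

/-! ### The model, its chain of submodels and the rank function `F` -/

/-- The linear order `M` is `θ`-like: it has cardinality `θ`, and every proper initial segment has
smaller cardinality. -/
def IsThetaLike (θ : Cardinal.{w}) (M : Type w) [LinearOrder M] : Prop :=
  #M = θ ∧ ∀ a : M, #(Set.Iio a) < θ

/-- `⟨N i | i < θ⟩` is a continuous chain of elementary submodels of `M` with union `M`, in which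
later members are end extensions of earlier ones. (Values `N i` for `i ≥ θ` are irrelevant.) -/
structure IsElementaryEndChain (θ : Cardinal.{w}) {K : FirstOrder.Language.{u, u}} {M : Type w}
    [LinearOrder M] [K.Structure M] (N : Ordinal.{w} → K.ElementarySubstructure M) : Prop where
  mono : ∀ i j, i < j → j < θ.ord → N i ≤ N j
  end_ext : ∀ i j, i < j → j < θ.ord → ∀ a ∈ N i, ∀ b ∈ N j, b ∉ N i → a < b
  continuous : ∀ i, IsSuccLimit i → i < θ.ord → ∀ a ∈ N i, ∃ j < i, a ∈ N j
  cover : ∀ a : M, ∃ i < θ.ord, a ∈ N i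

/-- `F(a)` is the least `i < θ` with `a ∈ N i`. -/
noncomputable def rankFn (θ : Cardinal.{w}) {K : FirstOrder.Language.{u, u}} {M : Type w} [K.Structure M]
    (N : Ordinal.{w} → K.ElementarySubstructure M) (a : M) : Ordinal.{w} :=
  sInf {i | i < θ.ord ∧ a ∈ N i}

/-! ### Matrices, the game and superlarge sets -/

section Game

variable {M : Type w} [LinearOrder M]

/-- `[X]^r`: the increasing `r`-sequences of elements of `X`. -/
def incSeq (X : Set M) (r : ℕ) : Set (Fin r → M) := {x | StrictMono x ∧ ∀ j, x j ∈ X}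

/-- `[F|A]^{r,s}`: the `s`-tuples of increasing `r`-sequences of elements of `A` such that `F` is
constant on each sequence and increases strictly from one sequence to the next. -/
def matricesOn (F : M → Ordinal.{w}) (A : Set M) (r s : ℕ) : Set (Fin s → Fin r → M) :=
  {x | (∀ i, x i ∈ incSeq A r) ∧ (∀ i j l, F (x i j) = F (x i l)) ∧
    ∀ i i', i < i' → ∀ j, F (x i j) < F (x i' j)}

/-- `[F]^{r,s}` -/
def matrices (F : M → Ordinal.{w}) (r s : ℕ) : Set (Fin s → Fin r → M) :=
  matricesOn F Set.univ r s

/-- `∏_{1 ≤ i ≤ e} [X_i]^r × [F|A]^{r,s-e}` for `e ≤ s`, as a set of `s`-tuples of `r`-sequences: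
the first `e` rows are in `[X_1]^r, …, [X_e]^r`, the other `s - e` rows form an element of
`[F|A]^{r,s-e}` (no condition if `s = e`). `X_i` is written `X k` with `k = i - 1 : Fin e`. -/
def winSet (F : M → Ordinal.{w}) {e : ℕ} (X : Fin e → Set M) (A : Set M) (r s : ℕ) :
    Set (Fin s → Fin r → M) :=
  {x | (∀ (i : Fin s) (h : (i : ℕ) < e), x i ∈ incSeq (X ⟨i, h⟩) r) ∧
    (fun k : Fin (s - e) => x ⟨e + k, by omega⟩) ∈ matricesOn F A r (s - e)}

/-- Player II wins the run of the game `G(S, e)` in which player I chose the cardinals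
`μ_1, …, μ_e` and player II chose the ordinals `β_1, …, β_e` (here `μ k`, `β k` with `k : Fin e`
numbered from `0`) and `β_{e+i}` for `1 ≤ i < θ` (here `γ i`; other values of `γ` are irrelevant).
Here `X k` stands for `X_{k+1}` and `Z i` for `X_{e+i}`. -/
def WinsII (θ : Cardinal.{w}) (F : M → Ordinal.{w}) {r s : ℕ} (S : Set (Fin s → Fin r → M))
    {e : ℕ} (μ : Fin e → Cardinal.{w}) (β : Fin e → Ordinal.{w})
    (γ : Ordinal.{w} → Ordinal.{w}) : Prop :=
  ((∀ k, β k < θ.ord) ∧ ∀ i, 1 ≤ i → i < θ.ord → γ i < θ.ord) ∧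
  (StrictMono β ∧ (∀ k i, 1 ≤ i → i < θ.ord → β k < γ i) ∧
    ∀ i j, 1 ≤ i → i < j → j < θ.ord → γ i < γ j) ∧
  ∃ (X : Fin e → Set M) (Z : Ordinal.{w} → Set M),
    (∀ k, X k ⊆ F ⁻¹' {β k} ∧ #(X k) = μ k) ∧
    (∀ i, 1 ≤ i → i < θ.ord → Z i ⊆ F ⁻¹' {γ i}) ∧
    IsLUB {κ : Cardinal.{w} | ∃ i, 1 ≤ i ∧ i < θ.ord ∧ κ = #(Z i)} θ ∧
    winSet F X (⋃ i ∈ {i : Ordinal.{w} | 1 ≤ i ∧ i < θ.ord}, Z i) r s ⊆ S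

/-- A strategy of player II in a game with `e` rounds: `head k` answers the cardinals
`μ_1, …, μ_{k+1}` by `β_{k+1}`, and `tail` answers `μ_1, …, μ_e` by the rest `⟨β_{e+i}⟩_{1 ≤ i < θ}`
of the last move (whose first ordinal `β_e` is given by `head`). -/
structure StrategyII (e : ℕ) where
  head : (k : Fin e) → (Set.Iic k → Cardinal.{w}) → Ordinal.{w}
  tail : (Fin e → Cardinal.{w}) → Ordinal.{w} → Ordinal.{w}

/-- The strategy `st` of player II wins every run of `G(S, e)` in which player I chooses
cardinals below `θ`. -/
def StrategyII.IsWinning (θ : Cardinal.{w}) (F : M → Ordinal.{w}) {r s : ℕ}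
    (S : Set (Fin s → Fin r → M)) {e : ℕ} (st : StrategyII.{w} e) : Prop :=
  ∀ μ : Fin e → Cardinal.{w}, (∀ k, μ k < θ) →
    WinsII θ F S μ (fun k => st.head k fun i => μ i) (st.tail μ)

/-- `S ⊆ [F]^{r,s}` is `e`-superlarge, `1 ≤ e ≤ s`. -/
structure IsSuperlarge (θ : Cardinal.{w}) (F : M → Ordinal.{w}) {r s : ℕ}
    (S : Set (Fin s → Fin r → M)) (e : ℕ) : Prop where
  one_le : 1 ≤ e
  le : e ≤ s
  subset : S ⊆ matrices F r s
  wins : ∃ st : StrategyII.{w} e, st.IsWinning θ F S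

end Game

end Superlarge

/-!
By the case of no sentences, an `e`-superlarge set is `(e' - 1)`-superlarge, so let `e' = e + 1`.

Colour a finite set `t ⊆ M` by the set of all triples `(k, y, b)` such that the term of `σ_k` takes
the value `b` when its constants in row `e + 1` are interpreted, in increasing order, by the
elements of `t`, and those in lower rows by `y`. The sentence `σ_k` only concerns values `b` below
an entry in row `e`. As `M` is `θ`-like and the sets `X_1, …, X_e` of a run of the game have fewer
than `θ` elements, fewer than `θ` triples matter, and so fewer than `θ` colours.

By the Erdős–Rado theorem every set `X_{e+i}` of sufficient size has a large homogeneous subset, and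
by regularity of `θ` one pattern of colours occurs for unboundedly many `i` and all sizes below `θ`.
Thin out the sets `X_{e+i}` to homogeneous sets with this pattern, the first of which has size
`μ_{e+1}`. Then the entries that `σ_k` takes from row `e + 1` and those it takes from row `u` have
the same colour, so the term takes the same value on both.
-/

namespace Superlarge

/-! ### The Erdős–Rado theorem below a strong limit cardinal -/

theorem power_lt_of_isStrongLimit {θ a b : Cardinal.{w}} (hθ : θ.IsStrongLimit) (ha : a < θ)
    (hb : b < θ) : a ^ b < θ :=
  calc a ^ b ≤ (2 ^ a) ^ b := power_le_power_right (cantor a).le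
    _ = 2 ^ (a * b) := power_mul.symm
    _ < θ := hθ.isStrongPrelimit (mul_lt_of_lt hθ.aleph0_le ha hb)

theorem mk_finset_le_two_power (α : Type w) : #(Finset α) ≤ 2 ^ #α :=
  (mk_le_of_injective Finset.coe_injective).trans_eq mk_set

section EndHomogeneous

variable {α C ι : Type w} [DecidableEq α] [LinearOrder ι] [WellFoundedLT ι] {f : Finset α → C}
  {X : Set α}

/-- The elements of `X \ B` with the same type as `x` over `B`, where the type of `z` over `B` is
the family of colours of the finite sets `{z} ∪ t` with `t ⊆ B`. -/
def sameTypeOver (f : Finset α → C) (X B : Set α) (x : α) : Set α :=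
  {z ∈ X \ B | ∀ t : Finset α, ↑t ⊆ B → f (insert z t) = f (insert x t)}

/-- The branch of `x` in the Erdős–Rado tree of the colouring `f` of finite subsets of `X`: each
term has the same type as `x` over the set of earlier terms. The terms are junk after the first
one that is equal to `x`. -/
noncomputable def typeBranch (f : Finset α → C) (X : Set α) (x : α) : ι → α :=
  wellFounded_lt.fix fun i branch => Classical.epsilon (h := ⟨x⟩) fun z =>
    z ∈ sameTypeOver f X (Set.range fun j : Set.Iio i => branch j.1 j.2) x

theorem typeBranch_eq_epsilon (f : Finset α → C) (X : Set α) (x : α) (i : ι) :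
    typeBranch f X x i = Classical.epsilon (h := ⟨x⟩) fun z =>
      z ∈ sameTypeOver f X (typeBranch f X x '' Set.Iio i) x := by
  rw [Set.image_eq_range]
  exact wellFounded_lt.fix_eq _ i

theorem typeBranch_mem_sameTypeOver {x : α} (hx : x ∈ X) {i : ι}
    (hi : ∀ j < i, typeBranch f X x j ≠ x) :
    typeBranch f X x i ∈ sameTypeOver f X (typeBranch f X x '' Set.Iio i) x := by
  have hself : x ∈ sameTypeOver f X (typeBranch f X x '' Set.Iio i) x :=
    ⟨⟨hx, fun ⟨j, hj, hjx⟩ => hi j hj hjx⟩, fun _ _ => rfl⟩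
  rw [typeBranch_eq_epsilon f X x i]
  exact Classical.epsilon_spec (p := (· ∈ sameTypeOver f X (typeBranch f X x '' Set.Iio i) x))
    ⟨x, hself⟩

theorem typeBranch_congr {x y : α}
    (h : ∀ t : Finset ι, f (insert x (t.image (typeBranch f X x))) =
      f (insert y (t.image (typeBranch f X y)))) (i : ι) :
    typeBranch f X x i = typeBranch f X y i := by
  induction i using WellFoundedLT.induction with
  | ind i ih =>
    have himage : typeBranch f X x '' Set.Iio i = typeBranch f X y '' Set.Iio i :=
      Set.image_congr ih
    have htype : sameTypeOver f X (typeBranch f X x '' Set.Iio i) x =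
        sameTypeOver f X (typeBranch f X y '' Set.Iio i) y := by
      rw [← himage]
      ext z
      refine and_congr_right fun _ => forall₂_congr fun _ himg => ?_
      obtain ⟨t, ht, rfl⟩ := Finset.subset_set_image_iff.1 himg
      have heqOn : Set.EqOn (typeBranch f X x) (typeBranch f X y) t := fun j hj => ih j (ht hj)
      rw [h t, Finset.image_congr heqOn]
    rw [typeBranch_eq_epsilon f X x i, typeBranch_eq_epsilon f X y i, htype]

/-- If every branch reached its point, then `x` could be recovered from the length of its branch
and the colours along it. -/
theorem exists_forall_typeBranch_ne (f : Finset α → C) (hX : #(ι × (Finset ι → C)) < #X) :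
    ∃ x ∈ X, ∀ i : ι, typeBranch f X x i ≠ x := by
  by_contra! hreach
  choose len hlen using hreach
  refine hX.not_ge (mk_le_of_injective (f := fun x : X =>
    (len x.1 x.2, fun t : Finset ι => f (insert x.1 (t.image (typeBranch f X x.1))))) ?_)
  rintro ⟨x, hx⟩ ⟨y, hy⟩ hxy
  obtain ⟨hlen_eq, hcolours⟩ := Prod.mk.inj hxy
  have hbranch := typeBranch_congr (congrFun hcolours) (len x hx)
  rw [hlen x hx, hlen_eq, hlen y hy] at hbranch
  exact Subtype.ext hbranch

theorem exists_endHomogeneous_sequence (f : Finset α → C) (hX : #(ι × (Finset ι → C)) < #X) :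
    ∃ (x : α) (a : ι → α), Function.Injective a ∧ (∀ i, a i ∈ X) ∧
      ∀ (i : ι) (t : Finset ι), (∀ j ∈ t, j < i) →
        f (insert (a i) (t.image a)) = f (insert x (t.image a)) := by
  obtain ⟨x, hx, hne⟩ := exists_forall_typeBranch_ne f hX
  have hmem := fun i : ι => typeBranch_mem_sameTypeOver (f := f) hx (i := i) fun j _ => hne j
  refine ⟨x, typeBranch f X x, .of_lt_imp_ne fun i j hij heq => (hmem j).1.2 ⟨i, hij, heq⟩,
    fun i => (hmem i).1.1, fun i t ht => (hmem i).2 _ ?_⟩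
  rw [Finset.coe_image]
  exact Set.image_mono ht

theorem exists_endHomogeneous_subset {ν : Cardinal.{w}} (f : Finset α → C)
    (hX : ν * #C ^ (2 ^ ν : Cardinal) < #X) :
    ∃ x, ∃ Y ⊆ X, #Y = ν ∧ ∀ t : Finset α, ↑t ⊆ Y → t.Nonempty →
      ∃ y ∈ t, f t = f (insert x (t.erase y)) := by
  rcases eq_or_ne #C 0 with hC | hC
  · exact ((mk_eq_zero_iff.1 hC).false (f ∅)).elim
  have hν : #ν.ord.ToType = ν := by simp
  obtain ⟨x, a, ha, haX, hend⟩ := exists_endHomogeneous_sequence (ι := ν.ord.ToType) f <| by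
    refine lt_of_le_of_lt ?_ hX
    rw [mk_prod, Cardinal.lift_id, Cardinal.lift_id, ← power_def, hν]
    gcongr
    exact power_le_power_left hC ((mk_finset_le_two_power _).trans_eq (by rw [hν]))
  refine ⟨x, Set.range a, Set.range_subset_iff.2 haX, (mk_range_eq a ha).trans hν,
    fun t ht hne => ?_⟩
  rw [← Set.image_univ] at ht
  obtain ⟨t, -, rfl⟩ := Finset.subset_set_image_iff.1 ht
  rw [Finset.image_nonempty] at hne
  refine ⟨a (t.max' hne), Finset.mem_image_of_mem a (t.max'_mem hne), ?_⟩
  rw [← Finset.image_erase ha, ← hend _ _ fun j => t.lt_max'_of_mem_erase_max' hne,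
    ← Finset.image_insert, Finset.insert_erase (t.max'_mem hne)]

end EndHomogeneous

/-- `f t` is `c k` for every `k`-element subset `t` of `Y`, for all `k ≤ n` at once. -/
def IsHomogeneous {α : Type*} {C : Type*} (f : Finset α → C) (n : ℕ) (Y : Set α) (c : ℕ → C) :
    Prop :=
  ∀ t : Finset α, ↑t ⊆ Y → t.card ≤ n → f t = c t.card

theorem IsHomogeneous.mono {α C : Type*} {f : Finset α → C} {n : ℕ} {Y Y' : Set α} {c : ℕ → C}
    (h : IsHomogeneous f n Y c) (hY : Y' ⊆ Y) : IsHomogeneous f n Y' c :=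
  fun t ht => h t (ht.trans hY)

/-- The partition relation `ν → (μ)^{≤ n}_κ`: for every colouring with at most `κ` colours of the
finite subsets of a set of size at least `ν`, there is a subset of size at least `μ` in which the
colour of a set with at most `n` elements depends only on its number of elements. -/
def PartitionArrow (ν μ κ : Cardinal.{w}) (n : ℕ) : Prop :=
  ∀ (α C : Type w) (f : Finset α → C) (X : Set α), #C ≤ κ → ν ≤ #X →
    ∃ Y ⊆ X, μ ≤ #Y ∧ ∃ c, IsHomogeneous f n Y c

theorem partitionArrow_zero (μ κ : Cardinal.{w}) : PartitionArrow μ μ κ 0 := by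
  refine fun α C f X _ hX => ⟨X, subset_rfl, hX, fun _ => f ∅, fun t _ ht => ?_⟩
  rw [Finset.card_eq_zero.1 (Nat.le_zero.1 ht)]

theorem PartitionArrow.succ {ν μ κ : Cardinal.{w}} {n : ℕ} (h : PartitionArrow ν μ κ n) :
    PartitionArrow (succ (ν * κ ^ (2 ^ ν : Cardinal))) μ κ (n + 1) := by
  classical
  intro α C f X hC hX
  obtain ⟨x, X', hX', hνX', hend⟩ := exists_endHomogeneous_subset (ν := ν) f <|
    calc ν * #C ^ (2 ^ ν : Cardinal) ≤ ν * κ ^ (2 ^ ν : Cardinal) := by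
          gcongr
          exact power_le_power_right hC
      _ < #X := succ_le_iff.1 hX
  obtain ⟨Y, hY, hμ, c, hc⟩ := h α C (fun t => f (insert x t)) X' hC hνX'.ge
  refine ⟨Y, hY.trans hX', hμ, fun k => k.casesOn (f ∅) c, fun t ht htn => ?_⟩
  rcases t.eq_empty_or_nonempty with rfl | hne
  · rfl
  obtain ⟨y, hy, hty⟩ := hend t (ht.trans hY) hne
  have hcard : t.card = (t.erase y).card + 1 := (Finset.card_erase_add_one hy).symm
  have herase : ↑(t.erase y) ⊆ Y := (Finset.coe_subset.2 (t.erase_subset y)).trans ht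
  rw [hty, hcard]
  exact hc _ herase (by omega)

theorem exists_partitionArrow {θ μ κ : Cardinal.{w}} (hθ : θ.IsStrongLimit) (hμ : μ < θ)
    (hκ : κ < θ) (n : ℕ) : ∃ ν < θ, PartitionArrow ν μ κ n := by
  induction n with
  | zero => exact ⟨μ, hμ, partitionArrow_zero μ κ⟩
  | succ n ih =>
    obtain ⟨ν, hν, harrow⟩ := ih
    exact ⟨_, hθ.isSuccLimit.succ_lt (mul_lt_of_lt hθ.aleph0_le hν
      (power_lt_of_isStrongLimit hθ hκ (hθ.isStrongPrelimit hν))), harrow.succ⟩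

/-! ### Families indexed by the ordinals below a regular cardinal -/

section Regular

variable {θ : Cardinal.{w}}

theorem lift_mk_Iio_lt_cof (hθ : θ.IsRegular) {β : Ordinal.{w}} (hβ : β < θ.ord) :
    Cardinal.lift.{w, w + 1} #(Set.Iio β) < (Ordinal.lift.{w + 1} θ.ord).cof := by
  rw [← lift_cof, hθ.cof_ord, Cardinal.mk_Iio_ordinal, Cardinal.lift_lift, Cardinal.lift_lt]
  exact Cardinal.lt_ord.1 hβ

theorem iSup_Iio_lt (hθ : θ.IsRegular) {β : Ordinal.{w}} (hβ : β < θ.ord)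
    {κ : Set.Iio β → Cardinal.{w}} (hκ : ∀ i, κ i < θ) : ⨆ i, κ i < θ := by
  refine lift_iSup_lt_of_lt_cof_ord ?_ hκ
  rw [← lift_ord]
  exact lift_mk_Iio_lt_cof hθ hβ

theorem iSup_Iio_lt_ord (hθ : θ.IsRegular) {β : Ordinal.{w}} (hβ : β < θ.ord)
    {g : Set.Iio β → Ordinal.{w}} (hg : ∀ i, g i < θ.ord) : ⨆ i, g i < θ.ord :=
  Ordinal.lift_iSup_lt_of_lt_cof (lift_mk_Iio_lt_cof hθ hβ) hg

theorem exists_gt_le_of_isLUB (hθ : θ.IsRegular) {size : Ordinal.{w} → Cardinal.{w}}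
    (hsize : ∀ i ∈ Set.Ico 1 θ.ord, size i < θ) (hlub : IsLUB (size '' Set.Ico 1 θ.ord) θ)
    {κ : Cardinal.{w}} (hκ : κ < θ) {i₀ : Ordinal.{w}} (hi₀ : i₀ < θ.ord) :
    ∃ i, i₀ < i ∧ i < θ.ord ∧ κ ≤ size i := by
  have hsucc : succ i₀ < θ.ord := (isSuccLimit_ord hθ.aleph0_le).succ_lt hi₀
  let early (i : Set.Iio (succ i₀)) : Cardinal.{w} := if 1 ≤ i.1 then size i.1 else 0
  have hearly : ⨆ i, early i < θ := iSup_Iio_lt hθ hsucc fun i => by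
    dsimp only [early]
    split_ifs with h
    · exact hsize i ⟨h, i.2.trans hsucc⟩
    · exact hθ.pos
  obtain ⟨_, ⟨i, hi, rfl⟩, hlt⟩ := (lt_isLUB_iff hlub).1 (max_lt hκ hearly)
  refine ⟨i, lt_of_not_ge fun hle => ?_, hi.2, (le_max_left _ _).trans hlt.le⟩
  have hle_early : size i ≤ ⨆ i, early i := by
    simpa only [early, if_pos hi.1] using le_ciSup (f := early) Cardinal.bddAbove_of_small
      ⟨i, lt_succ_iff.2 hle⟩
  exact hlt.not_ge (hle_early.trans (le_max_right _ _))

theorem exists_strictMonoOn_of_unbounded (hθ : θ.IsRegular) {P : Ordinal.{w} → Ordinal.{w} → Prop}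
    (hP : ∀ ξ < θ.ord, ∀ i₀ < θ.ord, ∃ i, i₀ < i ∧ i < θ.ord ∧ P ξ i) {b : Ordinal.{w}}
    (hb : b < θ.ord) :
    ∃ g : Ordinal.{w} → Ordinal.{w}, StrictMonoOn g (Set.Iio θ.ord) ∧
      ∀ ξ < θ.ord, b < g ξ ∧ g ξ < θ.ord ∧ P ξ (g ξ) := by
  choose! next hnext using hP
  let g : Ordinal.{w} → Ordinal.{w} := wellFounded_lt.fix fun ξ g =>
    next ξ (max b (⨆ η : Set.Iio ξ, g η.1 η.2))
  have hg : ∀ ξ, g ξ = next ξ (max b (⨆ η : Set.Iio ξ, g η.1)) := wellFounded_lt.fix_eq _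
  have hbelow : ∀ ξ < θ.ord, max b (⨆ η : Set.Iio ξ, g η.1) < θ.ord := fun ξ => by
    induction ξ using WellFoundedLT.induction with
    | ind ξ ih =>
      refine fun hξ => max_lt hb (iSup_Iio_lt_ord hθ hξ fun ⟨η, hη⟩ => ?_)
      rw [hg]
      exact (hnext η (hη.trans hξ) _ (ih η hη (hη.trans hξ))).2.1
  have hspec := fun ξ (hξ : ξ < θ.ord) => hnext ξ hξ _ (hbelow ξ hξ)
  simp only [← hg] at hspec
  refine ⟨g, fun ξ _ η hη hξη => lt_of_le_of_lt (le_max_of_le_right ?_) (hspec η hη).1,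
    fun ξ hξ => ⟨(le_max_left _ _).trans_lt (hspec ξ hξ).1, (hspec ξ hξ).2⟩⟩
  exact le_ciSup (f := fun η' : Set.Iio η => g η'.1) Ordinal.bddAbove_of_small ⟨ξ, hξη⟩

end Regular

theorem image_mk_Ico {α : Type w} (θ : Cardinal.{w}) (Z : Ordinal.{w} → Set α) :
    (fun i => #(Z i)) '' Set.Ico 1 θ.ord = {κ | ∃ i, 1 ≤ i ∧ i < θ.ord ∧ κ = #(Z i)} := by
  ext κ
  simp only [Set.mem_image, Set.mem_Ico, Set.mem_ofPred_eq, and_assoc, eq_comm]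

theorem exists_uniform_colour {θ : Cardinal.{w}} (hθ : θ.IsInaccessible) {α C : Type w}
    (hC : #C < θ) (f : Finset α → C) (n : ℕ) {Z : Ordinal.{w} → Set α}
    (hZ : ∀ κ < θ, ∀ i₀ < θ.ord, ∃ i, i₀ < i ∧ i < θ.ord ∧ κ ≤ #(Z i)) :
    ∃ c : ℕ → C, ∀ κ < θ, ∀ i₀ < θ.ord, ∃ i, i₀ < i ∧ i < θ.ord ∧
      ∃ Y ⊆ Z i, κ ≤ #Y ∧ IsHomogeneous f n Y c := by
  by_contra! hbad
  choose κ hκ i hi hbad using hbad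
  have hpatterns : #(ℕ → C) < θ.ord.cof := by
    rw [hθ.isRegular.cof_ord, mk_arrow]
    simpa using power_lt_of_isStrongLimit hθ.isStrongLimit hC hθ.aleph0_lt
  obtain ⟨ν, hν, harrow⟩ := exists_partitionArrow hθ.isStrongLimit
    (iSup_lt_of_lt_cof_ord hpatterns hκ) hC n
  obtain ⟨j, hj, hjθ, hνj⟩ := hZ ν hν _ (Ordinal.iSup_lt_of_lt_cof hpatterns hi)
  obtain ⟨Y, hYZ, hY, c, hc⟩ := harrow α C f (Z j) le_rfl hνj
  exact hbad c j ((le_ciSup Ordinal.bddAbove_of_small c).trans_lt hj) hjθ Y hYZ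
    ((le_ciSup Cardinal.bddAbove_of_small c).trans hY) hc

theorem exists_homogeneous_thinning {θ : Cardinal.{w}} (hθ : θ.IsInaccessible) {α C : Type w}
    (hC : #C < θ) (f : Finset α → C) (n : ℕ) {Z : Ordinal.{w} → Set α}
    (hZ : ∀ i ∈ Set.Ico 1 θ.ord, #(Z i) < θ)
    (hlub : IsLUB ((fun i => #(Z i)) '' Set.Ico 1 θ.ord) θ) {μ : Cardinal.{w}} (hμ : μ < θ) :
    ∃ c, ∃ i ∈ Set.Ico 1 θ.ord, ∃ Y ⊆ Z i, #Y = μ ∧ IsHomogeneous f n Y c ∧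
      ∃ (g : Ordinal.{w} → Ordinal.{w}) (W : Ordinal.{w} → Set α),
        StrictMonoOn g (Set.Iio θ.ord) ∧ ∀ ξ < θ.ord, i < g ξ ∧ g ξ < θ.ord ∧
          W ξ ⊆ Z (g ξ) ∧ ξ.card ≤ #(W ξ) ∧ IsHomogeneous f n (W ξ) c := by
  obtain ⟨c, hc⟩ := exists_uniform_colour hθ hC f n fun κ hκ i₀ hi₀ =>
    exists_gt_le_of_isLUB hθ.isRegular hZ hlub hκ hi₀
  have h1θ : (1 : Ordinal.{w}) < θ.ord :=
    Ordinal.one_lt_omega0.trans_le (omega0_le_ord.2 hθ.isRegular.aleph0_le)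
  obtain ⟨i, h1i, hiθ, Y', hY', hμY', hY'c⟩ := hc μ hμ 1 h1θ
  obtain ⟨Y, hYY', hμY⟩ := Cardinal.le_mk_iff_exists_subset.1 hμY'
  obtain ⟨g, hg, hgspec⟩ := exists_strictMonoOn_of_unbounded hθ.isRegular
    (fun ξ hξ => hc ξ.card (Cardinal.lt_ord.1 hξ)) hiθ
  choose! hig hgθ W hW using hgspec
  exact ⟨c, i, ⟨h1i.le, hiθ⟩, Y, hYY'.trans hY', hμY, hY'c.mono hYY', g, W, hg,
    fun ξ hξ => ⟨hig ξ hξ, hgθ ξ hξ, hW ξ hξ⟩⟩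

/-! ### Fibres of the rank function -/

theorem IsElementaryEndChain.monotone_rankFn {θ : Cardinal.{w}}
    {K : FirstOrder.Language.{u, u}} {M : Type w} [LinearOrder M] [K.Structure M]
    {N : Ordinal.{w} → K.ElementarySubstructure M} (hN : IsElementaryEndChain θ N) :
    Monotone (rankFn θ N) := by
  have hmem (a : M) : rankFn θ N a < θ.ord ∧ a ∈ N (rankFn θ N a) :=
    csInf_mem (s := {i | i < θ.ord ∧ a ∈ N i}) (hN.cover a)
  intro a b hab
  by_contra! hlt
  have hnotMem : a ∉ N (rankFn θ N b) := fun h =>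
    hlt.not_ge (csInf_le' (s := {i | i < θ.ord ∧ a ∈ N i}) ⟨(hmem b).1, h⟩)
  exact hab.not_gt (hN.end_ext _ _ hlt (hmem a).1 b (hmem b).2 a (hmem a).2 hnotMem)

section Game

variable {M : Type w} [LinearOrder M] {θ : Cardinal.{w}} {F : M → Ordinal.{w}} {r s e : ℕ}
  {S S' : Set (Fin s → Fin r → M)}

theorem mk_fibre_lt_of_lt (hM : ∀ a : M, #(Set.Iio a) < θ) (hF : Monotone F) {β : Ordinal.{w}}
    {a : M} (ha : β < F a) : #(F ⁻¹' {β}) < θ := by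
  refine (mk_le_mk_of_subset fun b hb => ?_).trans_lt (hM a)
  obtain rfl : F b = β := hb
  exact hF.reflect_lt ha

theorem IsSuperlarge.exists_large_fibre_below (hθ : 0 < θ) (hS : IsSuperlarge θ F S e)
    {κ : Cardinal.{w}} (hκ : κ < θ) : ∃ a, ∃ b < F a, κ ≤ #(F ⁻¹' {b}) := by
  obtain ⟨st, hst⟩ := hS.wins
  obtain ⟨-, ⟨-, hβγ, -⟩, X, Z, hX, hZ, hlub, -⟩ := hst (fun _ => κ) fun _ => hκ
  obtain ⟨_, ⟨i, h1, hi, rfl⟩, hpos⟩ := (lt_isLUB_iff hlub).1 hθ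
  obtain ⟨a, ha⟩ := mk_ne_zero_iff.1 hpos.ne'
  let k : Fin e := ⟨0, hS.one_le⟩
  have haγ : F a = st.tail (fun _ => κ) i := hZ i h1 hi ha
  exact ⟨a, _, (hβγ k i h1 hi).trans_eq haγ.symm,
    (hX k).2.symm.trans_le (mk_le_mk_of_subset (hX k).1)⟩

theorem IsSuperlarge.mk_fibre_lt (hθ : θ.IsInaccessible) (hM : ∀ a : M, #(Set.Iio a) < θ)
    (hF : Monotone F) (hS : IsSuperlarge θ F S e) {β : Ordinal.{w}} (hβ : β < θ.ord) :
    #(F ⁻¹' {β}) < θ := by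
  by_contra hlarge
  have hmax (a : M) : F a ≤ β := not_lt.1 fun h => hlarge (mk_fibre_lt_of_lt hM hF h)
  obtain ⟨a, rfl⟩ : (F ⁻¹' {β}).Nonempty := by
    rw [Set.nonempty_iff_ne_empty]
    intro hempty
    exact hlarge (by simpa only [hempty, mk_eq_zero] using hθ.pos)
  have hbelow : ⨆ i : Set.Iio (F a), #(F ⁻¹' {i.1}) < θ :=
    iSup_Iio_lt hθ.isRegular hβ fun i => mk_fibre_lt_of_lt hM hF i.2
  obtain ⟨top, b, hb, hle⟩ := hS.exists_large_fibre_below hθ.pos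
    (hθ.isSuccLimit.succ_lt hbelow)
  exact (succ_le_iff.1 hle).not_ge
    (le_ciSup (f := fun i : Set.Iio (F a) => #(F ⁻¹' {i.1})) Cardinal.bddAbove_of_small
      ⟨b, hb.trans_le (hmax top)⟩)

/-! ### Extending a run by one round -/

theorem mem_winSet_iff {X : Fin e → Set M} {A : Set M} {x : Fin s → Fin r → M} :
    x ∈ winSet F X A r s ↔ (∀ (i : Fin s) (h : (i : ℕ) < e), x i ∈ incSeq (X ⟨i, h⟩) r) ∧
      (∀ i : Fin s, e ≤ i → x i ∈ incSeq A r) ∧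
      (∀ i : Fin s, e ≤ i → ∀ j l, F (x i j) = F (x i l)) ∧
      ∀ i i' : Fin s, e ≤ i → i < i' → ∀ j, F (x i j) < F (x i' j) := by
  have hshift (i : Fin s) (hi : e ≤ i) : ∃ (k : Fin (s - e)) (h : e + k < s), i = ⟨e + k, h⟩ :=
    ⟨⟨i - e, by omega⟩, by simp only; omega, Fin.ext (Nat.add_sub_cancel' hi).symm⟩
  refine and_congr_right fun _ => ⟨fun ⟨hA, hconst, hlt⟩ => ⟨fun i hi => ?_, fun i hi => ?_,
    fun i i' hi hii' => ?_⟩, fun ⟨hA, hconst, hlt⟩ => ⟨fun k => hA _ (Nat.le_add_right _ _),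
    fun k => hconst _ (Nat.le_add_right _ _), fun k k' hkk' =>
    hlt _ _ (Nat.le_add_right _ _) (Nat.add_lt_add_left hkk' e)⟩⟩
  · obtain ⟨k, _, rfl⟩ := hshift i hi
    exact hA k
  · obtain ⟨k, _, rfl⟩ := hshift i hi
    exact hconst k
  · obtain ⟨k, _, rfl⟩ := hshift i hi
    obtain ⟨k', _, rfl⟩ := hshift i' (hi.trans hii'.le)
    exact hlt k k' (Nat.lt_of_add_lt_add_left hii')

theorem incSeq_mono {A B : Set M} (h : A ⊆ B) (r : ℕ) : incSeq A r ⊆ incSeq B r :=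
  fun _ hx => ⟨hx.1, fun j => h (hx.2 j)⟩

theorem winSet_snoc_subset {X : Fin e → Set M} {A Y A' : Set M} {β : Ordinal.{w}} (hYA : Y ⊆ A)
    (hY : Y ⊆ F ⁻¹' {β}) (hA'A : A' ⊆ A) (hA' : ∀ a ∈ A', β < F a) :
    winSet F (Fin.snoc (α := fun _ => Set M) X Y) A' r s ⊆ winSet F X A r s := by
  intro x hx
  obtain ⟨hlow, hA, hconst, hlt⟩ := mem_winSet_iff.1 hx
  have hxY (i : Fin s) (hi : e = i) : x i ∈ incSeq Y r := by
    simpa [Fin.snoc, ← hi] using hlow i (hi ▸ Nat.lt_succ_self _)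
  refine mem_winSet_iff.2 ⟨fun i hi => ?_, fun i hi => ?_, fun i hi j l => ?_,
    fun i i' hi hii' j => ?_⟩
  · simpa [Fin.snoc, hi] using hlow i (hi.trans (Nat.lt_succ_self e))
  · rcases hi.eq_or_lt with hi | hi
    · exact incSeq_mono hYA r (hxY i hi)
    · exact incSeq_mono hA'A r (hA i hi)
  · rcases hi.eq_or_lt with hi | hi
    · exact (hY ((hxY i hi).2 j)).trans (hY ((hxY i hi).2 l)).symm
    · exact hconst i hi j l
  · rcases hi.eq_or_lt with hi | hi
    · exact (hY ((hxY i hi).2 j)).trans_lt (hA' _ ((hA i' (hi.trans_lt hii')).2 j))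
    · exact hlt i i' hi hii' j

theorem winSet_thinning_subset {ι : Type*} [Preorder ι] {I : Set ι} {γ : ι → Ordinal.{w}}
    (hγ : StrictMonoOn γ I) {Z W : ι → Set M} (hZ : ∀ i ∈ I, Z i ⊆ F ⁻¹' {γ i}) {i : ι}
    (hi : i ∈ I) {Y : Set M} (hY : Y ⊆ Z i) {g : ι → ι} (hg : ∀ ξ ∈ I, g ξ ∈ I)
    (hig : ∀ ξ ∈ I, i < g ξ) (hW : ∀ ξ ∈ I, W ξ ⊆ Z (g ξ)) {X : Fin e → Set M} :
    winSet F (Fin.snoc (α := fun _ => Set M) X Y) (⋃ ξ ∈ I, W ξ) r s ⊆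
      winSet F X (⋃ i ∈ I, Z i) r s := by
  refine winSet_snoc_subset (hY.trans (Set.subset_biUnion_of_mem (u := Z) hi)) (hY.trans (hZ i hi))
    (Set.iUnion₂_subset fun ξ hξ => (hW ξ hξ).trans (Set.subset_biUnion_of_mem (u := Z) (hg ξ hξ)))
    fun a ha => ?_
  obtain ⟨ξ, hξ, haξ⟩ := Set.mem_iUnion₂.1 ha
  exact (hγ hi (hg ξ hξ) (hig ξ hξ)).trans_eq (hZ _ (hg ξ hξ) (hW ξ hξ haξ)).symm

theorem exists_forall_mem_of_mem_biUnion {ι κ α β : Type*} {I : Set ι}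
    (hI : I.Nonempty) {F : α → β} {γ : ι → β} (hγ : Set.InjOn γ I) {W : ι → Set α}
    (hW : ∀ ξ ∈ I, W ξ ⊆ F ⁻¹' {γ ξ}) {x : κ → α} (hx : ∀ j, x j ∈ ⋃ ξ ∈ I, W ξ)
    (hF : ∀ j l, F (x j) = F (x l)) : ∃ ξ ∈ I, ∀ j, x j ∈ W ξ := by
  rcases isEmpty_or_nonempty κ with _ | ⟨⟨j₀⟩⟩
  · exact ⟨hI.some, hI.some_mem, isEmptyElim⟩
  obtain ⟨ξ, hξ, hj₀⟩ := Set.mem_iUnion₂.1 (hx j₀)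
  refine ⟨ξ, hξ, fun j => ?_⟩
  obtain ⟨η, hη, hj⟩ := Set.mem_iUnion₂.1 (hx j)
  have hγη : γ η = γ ξ := (hW η hη hj).symm.trans ((hF j j₀).trans (hW ξ hξ hj₀))
  rwa [← hγ hη hξ hγη]

theorem strictMono_snoc {α : Type*} [Preorder α] {β : Fin e → α} {b : α} (hβ : StrictMono β)
    (hb : ∀ k, β k < b) : StrictMono (Fin.snoc (α := fun _ => α) β b) := by
  intro k k' hkk'
  cases k' using Fin.lastCases with
  | last =>
    obtain ⟨k, rfl⟩ := Fin.exists_castSucc_eq.2 hkk'.ne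
    simpa only [Fin.snoc_castSucc, Fin.snoc_last] using hb k
  | cast k' =>
    obtain ⟨k, rfl⟩ := Fin.exists_castSucc_eq.2 (hkk'.trans (Fin.castSucc_lt_last k')).ne
    simpa only [Fin.snoc_castSucc] using hβ (Fin.castSucc_lt_castSucc_iff.1 hkk')

theorem isLUB_of_card_le (hθ : IsSuccLimit θ) {size : Ordinal.{w} → Cardinal.{w}}
    (hlt : ∀ ξ ∈ Set.Ico 1 θ.ord, size ξ < θ) (hle : ∀ ξ ∈ Set.Ico 1 θ.ord, ξ.card ≤ size ξ) :
    IsLUB (size '' Set.Ico 1 θ.ord) θ := by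
  refine ⟨Set.forall_mem_image.2 fun ξ hξ => (hlt ξ hξ).le, fun u hu => ?_⟩
  by_contra! huθ
  have hmem : (succ u).ord ∈ Set.Ico 1 θ.ord := by
    refine ⟨?_, ord_lt_ord.2 (hθ.succ_lt huθ)⟩
    rw [Order.one_le_iff_ne_zero, Ne, ord_eq_zero]
    exact (succ_pos u).ne'
  have hsucc_le : succ u ≤ u :=
    (card_ord _).symm.trans_le ((hle _ hmem).trans (hu (Set.mem_image_of_mem size hmem)))
  exact hsucc_le.not_gt (lt_succ u)

theorem isHomogeneous_range_of_mem_winSet_snoc {C : Type*} {f : Finset M → C} {n : ℕ} {c : ℕ → C}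
    {X : Fin e → Set M} {Y : Set M} {ι : Type*} {I : Set ι} (hI : I.Nonempty)
    {γ : ι → Ordinal.{w}} (hγ : Set.InjOn γ I) {W : ι → Set M}
    (hW : ∀ ξ ∈ I, W ξ ⊆ F ⁻¹' {γ ξ}) (hYc : IsHomogeneous f n Y c)
    (hWc : ∀ ξ ∈ I, IsHomogeneous f n (W ξ) c) {x : Fin s → Fin r → M}
    (hx : x ∈ winSet F (Fin.snoc (α := fun _ => Set M) X Y) (⋃ ξ ∈ I, W ξ) r s) {i : Fin s}
    (hi : e ≤ i) : IsHomogeneous f n (Set.range (x i)) c := by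
  obtain ⟨hlow, hA, hconst, -⟩ := mem_winSet_iff.1 hx
  rcases hi.eq_or_lt with hi | hi
  · have hxY : x i ∈ incSeq Y r := by
      simpa [Fin.snoc, ← hi] using hlow i (hi ▸ Nat.lt_succ_self _)
    exact hYc.mono (Set.range_subset_iff.2 hxY.2)
  · obtain ⟨ξ, hξ, hxξ⟩ := exists_forall_mem_of_mem_biUnion hI hγ hW (hA i hi).2 (hconst i hi)
    exact (hWc ξ hξ).mono (Set.range_subset_iff.2 hxξ)

/-- Membership in `S'` of a matrix `a ∈ S` whose first `e` rows lie in given small sets is ensured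
by one colouring with few colours, for which the other rows of `a` only have to be homogeneous
with the same colours. -/
def IsColourDetermined (θ : Cardinal.{w}) (S S' : Set (Fin s → Fin r → M)) (e : ℕ) : Prop :=
  ∀ X : Fin e → Set M, (∀ k, #(X k) < θ) →
    ∃ (C : Type w) (f : Finset M → C), #C < θ ∧ ∀ (c : ℕ → C), ∀ a ∈ S,
      (∀ (i : Fin s) (h : (i : ℕ) < e) (j : Fin r), a i j ∈ X ⟨i, h⟩) →
      (∀ i : Fin s, e ≤ i → IsHomogeneous f r (Set.range (a i)) c) → a ∈ S'

theorem winSet_thinning_subset_of_isHomogeneous {ι : Type*} [LinearOrder ι] {I : Set ι}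
    {γ : ι → Ordinal.{w}} (hγ : StrictMonoOn γ I) {Z W : ι → Set M}
    (hZ : ∀ i ∈ I, Z i ⊆ F ⁻¹' {γ i}) {i : ι} (hi : i ∈ I) {Y : Set M} (hY : Y ⊆ Z i) {g : ι → ι}
    (hg : StrictMonoOn g I) (hgI : ∀ ξ ∈ I, g ξ ∈ I) (hig : ∀ ξ ∈ I, i < g ξ)
    (hW : ∀ ξ ∈ I, W ξ ⊆ Z (g ξ)) {C : Type*} {f : Finset M → C} {n : ℕ} {c : ℕ → C}
    (hYc : IsHomogeneous f n Y c) (hWc : ∀ ξ ∈ I, IsHomogeneous f n (W ξ) c) {X : Fin e → Set M}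
    (hS : winSet F X (⋃ i ∈ I, Z i) r s ⊆ S)
    (hS' : ∀ x ∈ S, (∀ (k : Fin s) (h : (k : ℕ) < e), x k ∈ incSeq (X ⟨k, h⟩) r) →
      (∀ k : Fin s, e ≤ k → IsHomogeneous f n (Set.range (x k)) c) → x ∈ S') :
    winSet F (Fin.snoc (α := fun _ => Set M) X Y) (⋃ ξ ∈ I, W ξ) r s ⊆ S' := fun x hx => by
  have hxZ := winSet_thinning_subset hγ hZ hi hY hgI hig hW hx
  exact hS' x (hS hxZ) hxZ.1 fun k => isHomogeneous_range_of_mem_winSet_snoc ⟨i, hi⟩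
    (hγ.comp hg hgI).injOn (fun ξ hξ => (hW ξ hξ).trans (hZ _ (hgI ξ hξ))) hYc hWc hx

theorem WinsII.snoc (hθ : θ.IsInaccessible) (hF : ∀ β < θ.ord, #(F ⁻¹' {β}) < θ)
    (hS' : IsColourDetermined θ S S' e) {μ : Fin (e + 1) → Cardinal.{w}} (hμ : ∀ k, μ k < θ)
    {β : Fin e → Ordinal.{w}} {γ : Ordinal.{w} → Ordinal.{w}}
    (h : WinsII θ F S (fun k => μ k.castSucc) β γ) :
    ∃ (b : Ordinal.{w}) (γ' : Ordinal.{w} → Ordinal.{w}),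
      WinsII θ F S' μ (Fin.snoc (α := fun _ => Ordinal.{w}) β b) γ' := by
  obtain ⟨⟨hβθ, hγθ⟩, ⟨hβ, hβγ, hγ⟩, X, Z, hX, hZ, hlub, hsub⟩ := h
  obtain ⟨C, f, hC, hf⟩ := hS' X fun k => (hX k).2.trans_lt (hμ _)
  have hZθ (i) (hi : i ∈ Set.Ico 1 θ.ord) : #(Z i) < θ :=
    (mk_le_mk_of_subset (hZ i hi.1 hi.2)).trans_lt (hF _ (hγθ i hi.1 hi.2))
  rw [← image_mk_Ico] at hlub
  obtain ⟨c, i, hi, Y, hYZ, hμY, hYc, g, W, hg, hgW⟩ :=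
    exists_homogeneous_thinning hθ hC f r hZθ hlub (hμ (Fin.last e))
  choose hig hgθ hWZ hξW hWc using hgW
  have hgI (ξ) (hξ : ξ < θ.ord) : g ξ ∈ Set.Ico 1 θ.ord := ⟨hi.1.trans (hig ξ hξ).le, hgθ ξ hξ⟩
  have hWF (ξ) (hξ : ξ < θ.ord) : W ξ ⊆ F ⁻¹' {γ (g ξ)} :=
    (hWZ ξ hξ).trans (hZ _ (hgI ξ hξ).1 (hgθ ξ hξ))
  have hγ' : StrictMonoOn γ (Set.Ico 1 θ.ord) := fun i hi j hj hij => hγ i j hi.1 hij hj.2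
  have hsub' := winSet_thinning_subset_of_isHomogeneous hγ' (fun i hi => hZ i hi.1 hi.2) hi hYZ
    (hg.mono fun ξ hξ => hξ.2) (fun ξ hξ => hgI ξ hξ.2) (fun ξ hξ => hig ξ hξ.2)
    (fun ξ hξ => hWZ ξ hξ.2) hYc (fun ξ hξ => hWc ξ hξ.2) hsub fun x hxS hxX hxc =>
      hf c x hxS (fun k hk j => (hxX k hk).2 j) hxc
  refine ⟨γ i, fun ξ => γ (g ξ), ⟨Fin.forall_fin_succ'.2 ⟨?_, ?_⟩, fun ξ _ hξ =>
    hγθ _ (hgI ξ hξ).1 (hgθ ξ hξ)⟩, ⟨strictMono_snoc hβ fun k => hβγ k i hi.1 hi.2,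
    Fin.forall_fin_succ'.2 ⟨?_, ?_⟩, fun ξ η _ hξη hη =>
    hγ _ _ (hgI ξ (hξη.trans hη)).1 (hg (hξη.trans hη) hη hξη) (hgθ η hη)⟩,
    Fin.snoc (α := fun _ => Set M) X Y, W, Fin.forall_fin_succ'.2 ⟨?_, ?_⟩, fun ξ _ => hWF ξ,
    ?_, hsub'⟩
  · simpa only [Fin.snoc_castSucc] using hβθ
  · simpa only [Fin.snoc_last] using hγθ i hi.1 hi.2
  · simpa only [Fin.snoc_castSucc] using fun k ξ _ hξ => hβγ k _ (hgI ξ hξ).1 (hgθ ξ hξ)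
  · simpa only [Fin.snoc_last] using fun ξ _ hξ => hγ _ _ hi.1 (hig ξ hξ) (hgθ ξ hξ)
  · simpa only [Fin.snoc_castSucc] using hX
  · simpa only [Fin.snoc_last] using ⟨hYZ.trans (hZ i hi.1 hi.2), hμY⟩
  · rw [← image_mk_Ico]
    exact isLUB_of_card_le hθ.isSuccLimit (fun ξ hξ => (mk_le_mk_of_subset (hWZ ξ hξ.2)).trans_lt
      (hZθ _ (hgI ξ hξ.2))) fun ξ hξ => hξW ξ hξ.2

/-- The strategy in a game with one more round that plays `b` in the additional round, followed by
the sequence `γ`. -/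
def StrategyII.snoc (st : StrategyII.{w} e) (b : (Fin (e + 1) → Cardinal.{w}) → Ordinal.{w})
    (γ : (Fin (e + 1) → Cardinal.{w}) → Ordinal.{w} → Ordinal.{w}) : StrategyII.{w} (e + 1) where
  head := Fin.lastCases (motive := fun k => (Set.Iic k → Cardinal.{w}) → Ordinal.{w})
    (fun μ => b fun i => μ ⟨i, Fin.le_last i⟩)
    fun k μ => st.head k fun i => μ ⟨i.1.castSucc, Fin.castSucc_le_castSucc_iff.2 i.2⟩
  tail := γ

theorem StrategyII.snoc_head (st : StrategyII.{w} e)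
    (b : (Fin (e + 1) → Cardinal.{w}) → Ordinal.{w})
    (γ : (Fin (e + 1) → Cardinal.{w}) → Ordinal.{w} → Ordinal.{w})
    (μ : Fin (e + 1) → Cardinal.{w}) :
    (fun k => (st.snoc b γ).head k fun i => μ i) =
      Fin.snoc (α := fun _ => Ordinal.{w}) (fun k => st.head k fun i => μ i.1.castSucc) (b μ) := by
  ext k
  cases k using Fin.lastCases with
  | last => simp [snoc]
  | cast k => simp [snoc]

theorem IsSuperlarge.of_isColourDetermined (hθ : θ.IsInaccessible)
    (hF : ∀ β < θ.ord, #(F ⁻¹' {β}) < θ) (hes : e < s) (hS : IsSuperlarge θ F S e) (hSS' : S' ⊆ S)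
    (hS' : IsColourDetermined θ S S' e) : IsSuperlarge θ F S' (e + 1) := by
  obtain ⟨st, hst⟩ := hS.wins
  choose! b γ hbγ using fun (μ : Fin (e + 1) → Cardinal.{w}) (hμ : ∀ k, μ k < θ) =>
    (hst (fun k => μ k.castSucc) fun k => hμ _).snoc hθ hF hS' hμ
  refine ⟨Nat.le_add_left 1 e, hes, hSS'.trans hS.subset, st.snoc b γ, fun μ hμ => ?_⟩
  rw [StrategyII.snoc_head]
  exact hbγ μ hμ

theorem IsSuperlarge.of_le (hθ : θ.IsInaccessible) (hF : ∀ β < θ.ord, #(F ⁻¹' {β}) < θ)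
    (hS : IsSuperlarge θ F S e) {e' : ℕ} (hee' : e ≤ e') (hes : e' ≤ s) :
    IsSuperlarge θ F S e' := by
  induction e', hee' using Nat.le_induction with
  | base => exact hS
  | succ n _ ih =>
    have htrivial : IsColourDetermined θ S S n := fun _ _ =>
      ⟨PUnit, fun _ => PUnit.unit, mk_punit.trans_lt (one_lt_aleph0.trans hθ.aleph0_lt),
        fun _ _ ha _ _ => ha⟩
    exact (ih (Nat.le_of_succ_le hes)).of_isColourDetermined hθ hF hes subset_rfl htrivial

end Game

/-! ### Values of the term of a sentence of type (iv) -/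

theorem realize_congr_varFinset {K : FirstOrder.Language} {M α : Type*} [K.Structure M]
    [DecidableEq α] {t : K.Term α} {v v' : α → M} (h : Set.EqOn v v' t.varFinset) :
    t.realize v = t.realize v' := by
  induction t with
  | var k => exact h (by simp [FirstOrder.Language.Term.varFinset])
  | func f ts ih =>
    rw [FirstOrder.Language.Term.realize_func, FirstOrder.Language.Term.realize_func]
    congr 1
    ext i
    exact ih i fun k hk => h (Finset.mem_biUnion.2 ⟨i, Finset.mem_univ i, hk⟩)

theorem mem_varFinsetLeft_relabel {K : FirstOrder.Language} {α β γ : Type*} [DecidableEq α]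
    [DecidableEq β] {t : K.Term α} (g : α → β) {k : α} (hk : k ∈ t.varFinset) :
    g k ∈ (t.relabel (Sum.inl ∘ g : α → β ⊕ γ)).varFinsetLeft := by
  induction t with
  | var k' =>
    obtain rfl : k = k' := by simpa [FirstOrder.Language.Term.varFinset] using hk
    simp [FirstOrder.Language.Term.varFinsetLeft]
  | func f ts ih =>
    obtain ⟨i, -, hk⟩ := Finset.mem_biUnion.1 hk
    exact Finset.mem_biUnion.2 ⟨i, Finset.mem_univ i, ih i hk⟩

theorem eqOn_of_strictMonoOn_of_image_eq {ι α : Type*} [LinearOrder ι] [WellFoundedLT ι]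
    [Preorder α] {K : Set ι} {g g' : ι → α} (hg : StrictMonoOn g K) (hg' : StrictMonoOn g' K)
    (h : g '' K = g' '' K) : Set.EqOn g g' K := by
  have hrange : Set.range (K.domRestrict g) = Set.range (K.domRestrict g') := by
    rwa [Set.range_domRestrict, Set.range_domRestrict]
  have hrestrict := (StrictMono.range_inj hg.domRestrict hg'.domRestrict).1 hrange
  exact fun k hk => congrFun hrestrict ⟨k, hk⟩

theorem exists_eq_fin_add_one {n x : ℕ} (hx : 1 ≤ x ∧ x ≤ n) : ∃ i : Fin n, x = i + 1 :=
  ⟨⟨x - 1, by omega⟩, by simp only; omega⟩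

theorem IsHomogeneous.apply_image {α C κ : Type*} [DecidableEq α] {f : Finset α → C} {r : ℕ}
    {x : Fin r → α} {c : ℕ → C} (h : IsHomogeneous f r (Set.range x) c) {K : Finset κ} {g : κ → α}
    (hg : Set.InjOn g K) (hgx : ∀ k ∈ K, g k ∈ Set.range x) : f (K.image g) = c K.card := by
  have hsub : K.image g ⊆ Finset.univ.image x :=
    Finset.image_subset_iff.2 fun k hk => by simpa using hgx k hk
  have hcard : (K.image g).card ≤ r :=
    calc (K.image g).card ≤ (Finset.univ.image x).card := Finset.card_le_card hsub
      _ ≤ r := Finset.card_image_le.trans_eq (Finset.card_fin r)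
  have hrange : ↑(K.image g) ⊆ Set.range x := by
    rw [Finset.coe_image]
    exact Set.image_subset_iff.2 hgx
  rw [h _ hrange hcard, Finset.card_image_of_injOn hg]

namespace TypeIVData

variable {L : FirstOrder.Language.{u, u}} (d : TypeIVData L) {lt : L.Relations 2}

theorem mem_constantsIn_sentence {k : Fin (d.m + 1)} (hk : k ∈ d.τ.varFinset) :
    d.c k ∈ constantsIn (d.sentence lt) ∧ d.right k ∈ constantsIn (d.sentence lt) := by
  have hc := mem_varFinsetLeft_relabel (γ := Fin 0) d.c hk
  have hright := mem_varFinsetLeft_relabel (γ := Fin 0) d.right hk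
  simp only [constantsIn, sentence, Equiv.symm_apply_apply, FirstOrder.Language.Term.equal,
    FirstOrder.Language.Term.bdEqual, FirstOrder.Language.BoundedFormula.freeVarFinset,
    Finset.mem_union, FirstOrder.Language.Term.relabel_relabel]
  exact ⟨Or.inr (Or.inl hc), Or.inr (Or.inr hright)⟩

theorem bound_mem_constantsIn_sentence : (d.iota - 1, d.j) ∈ constantsIn (d.sentence lt) := by
  simp [constantsIn, sentence, FirstOrder.Language.BoundedFormula.freeVarFinset,
    FirstOrder.Language.Relations.formula₂, FirstOrder.Language.Relations.formula,
    FirstOrder.Language.Relations.boundedFormula, FirstOrder.Language.Term.varFinsetLeft]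

theorem fst_le_iota (k : Fin (d.m + 1)) : (d.c k).1 ≤ d.iota :=
  (Prod.Lex.le_iff.1 (d.c_increasing.monotone (Fin.le_last k))).elim le_of_lt fun h => h.1.le

/-- The variables of the term that stand for constants of the last row. -/
def topVars : Finset (Fin (d.m + 1)) := d.τ.varFinset.filter fun k => (d.c k).1 = d.iota

theorem mem_topVars {k : Fin (d.m + 1)} :
    k ∈ d.topVars ↔ k ∈ d.τ.varFinset ∧ (d.c k).1 = d.iota := Finset.mem_filter

variable {d}

theorem strictMonoOn_topVars {M : Type*} [Preorder M] {r : ℕ} {a : Fin r → M} (ha : StrictMono a)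
    {v : ℕ × ℕ → M} {i : ℕ} (hv : ∀ j : Fin r, v (i, j + 1) = a j)
    {w : Fin (d.m + 1) → ℕ × ℕ} (hw : StrictMono fun k => toLex (w k))
    (hrow : ∀ k ∈ d.topVars, ∃ j : Fin r, w k = (i, (j : ℕ) + 1)) :
    StrictMonoOn (v ∘ w) d.topVars := by
  intro k hk k' hk' hkk'
  obtain ⟨j, hj⟩ := hrow k hk
  obtain ⟨j', hj'⟩ := hrow k' hk'
  have hlex : toLex (i, (j : ℕ) + 1) < toLex (i, (j' : ℕ) + 1) := hj ▸ hj' ▸ hw hkk'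
  have hjj' : j < j' := by simpa [Prod.Lex.toLex_lt_toLex] using hlex
  simpa only [Function.comp_apply, hj, hj', hv] using ha hjj'

theorem exists_row {r s e : ℕ} (hes : e < s) {w : Fin (d.m + 1) → ℕ × ℕ} {n : ℕ}
    (hn : e < n) (hw : ∀ k ∈ d.topVars, (w k).1 = n)
    (hocc : ∀ k ∈ d.topVars, (1 ≤ (w k).1 ∧ (w k).1 ≤ s) ∧ (1 ≤ (w k).2 ∧ (w k).2 ≤ r)) :
    ∃ i : Fin s, e ≤ i ∧ ∀ k ∈ d.topVars, ∃ j : Fin r, w k = ((i : ℕ) + 1, (j : ℕ) + 1) := by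
  rcases d.topVars.eq_empty_or_nonempty with hempty | ⟨k₀, hk₀⟩
  · exact ⟨⟨e, hes⟩, le_rfl, by simp [hempty]⟩
  obtain ⟨i, hi⟩ := exists_eq_fin_add_one (hocc k₀ hk₀).1
  rw [hw k₀ hk₀] at hi
  refine ⟨i, by omega, fun k hk => ?_⟩
  obtain ⟨j, hj⟩ := exists_eq_fin_add_one (hocc k hk).2
  exact ⟨j, Prod.ext ((hw k hk).trans hi) hj⟩

theorem exists_eq_of_notMem_topVars {r s e : ℕ} (hde : d.iota = e + 1) {k : Fin (d.m + 1)}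
    (hk : k ∈ d.τ.varFinset) (hktop : k ∉ d.topVars)
    (hocc : (1 ≤ (d.c k).1 ∧ (d.c k).1 ≤ s) ∧ (1 ≤ (d.c k).2 ∧ (d.c k).2 ≤ r)) :
    ∃ (i : Fin e) (j : Fin r), d.c k = ((i : ℕ) + 1, (j : ℕ) + 1) := by
  have hlt_iota := (d.fst_le_iota k).lt_of_ne fun h => hktop (d.mem_topVars.2 ⟨hk, h⟩)
  obtain ⟨i, hi⟩ := exists_eq_fin_add_one ⟨hocc.1.1, Nat.le_of_lt_succ (hlt_iota.trans_eq hde)⟩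
  obtain ⟨j, hj⟩ := exists_eq_fin_add_one hocc.2
  exact ⟨i, j, Prod.ext hi hj⟩

section Value

variable {M : Type w} [LinearOrder M] [(skolemLanguage L).Structure M] {r s e : ℕ}
  {y : Fin e → Fin r → M} {t : Finset M} {b b' : M}

theorem satisfiesAt_sentence_iff
    (hlt : ∀ a b : M, FirstOrder.Language.Structure.RelMap (relSymbol L lt) ![a, b] ↔ a < b)
    {a : Fin s → Fin r → M} :
    SatisfiesAt (d.sentence lt) a ↔
      ∀ v : ℕ × ℕ → M, (∀ (i : Fin s) (j : Fin r), v (i + 1, j + 1) = a i j) →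
        d.τ.realize (v ∘ d.c) < v (d.iota - 1, d.j) →
        d.τ.realize (v ∘ d.c) = d.τ.realize (v ∘ d.right) := by
  refine forall₂_congr fun v _ => ?_
  let _ := FirstOrder.Language.constantsOn.structure v
  refine (FirstOrder.Language.Formula.realize_equivSentence M _).trans ?_
  rw [FirstOrder.Language.Formula.realize_imp, FirstOrder.Language.Formula.realize_rel₂,
    FirstOrder.Language.Formula.realize_equal, hlt]
  simp only [FirstOrder.Language.Term.realize_relabel, FirstOrder.Language.Term.realize_var]
  exact Iff.rfl

/-- The term takes the value `b` when its variables for the last row take the values in `t` in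
increasing order and the constants in the rows `y` below it are interpreted as the entries of `y`
(with indices shifted by `1`, as in `SatisfiesAt`). -/
def IsValue (d : TypeIVData L) (y : Fin e → Fin r → M) (t : Finset M) (b : M) : Prop :=
  ∃ g : Fin (d.m + 1) → M, StrictMonoOn g d.topVars ∧ g '' d.topVars = t ∧
    (∀ (k : Fin (d.m + 1)) (i : Fin e) (j : Fin r), d.c k = ((i : ℕ) + 1, (j : ℕ) + 1) →
      g k = y i j) ∧
    d.τ.realize g = b

theorem IsValue.unique
    (hlow : ∀ k ∈ d.τ.varFinset, k ∉ d.topVars →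
      ∃ (i : Fin e) (j : Fin r), d.c k = ((i : ℕ) + 1, (j : ℕ) + 1))
    (h : d.IsValue y t b) (h' : d.IsValue y t b') : b = b' := by
  obtain ⟨g, hg, hgt, hgy, rfl⟩ := h
  obtain ⟨g', hg', hgt', hgy', rfl⟩ := h'
  refine realize_congr_varFinset fun k hk => ?_
  by_cases htop : k ∈ d.topVars
  · exact eqOn_of_strictMonoOn_of_image_eq hg hg' (hgt.trans hgt'.symm) htop
  · obtain ⟨i, j, hc⟩ := hlow k hk htop
    rw [hgy k i j hc, hgy' k i j hc]

theorem isValue_realize (hde : d.iota = e + 1) {v : ℕ × ℕ → M}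
    (hv : ∀ (i : Fin e) (j : Fin r), v (i + 1, j + 1) = y i j) {w : Fin (d.m + 1) → ℕ × ℕ}
    (hmono : StrictMonoOn (v ∘ w) d.topVars) (hw : ∀ k, (d.c k).1 ≠ d.iota → w k = d.c k)
    (ht : v ∘ w '' d.topVars = t) : d.IsValue y t (d.τ.realize (v ∘ w)) := by
  refine ⟨v ∘ w, hmono, ht, fun k i j hk => ?_, rfl⟩
  have hne : (d.c k).1 ≠ d.iota := by
    rw [hk, hde]
    exact (Nat.succ_lt_succ i.2).ne
  rw [Function.comp_apply, hw k hne, hk, hv]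

theorem exists_isValue_of_isHomogeneous (hde : d.iota = e + 1) {a : Fin s → Fin r → M}
    (ha : ∀ i, StrictMono (a i)) {v : ℕ × ℕ → M}
    (hv : ∀ (i : Fin s) (j : Fin r), v (i + 1, j + 1) = a i j)
    (hvy : ∀ (i : Fin e) (j : Fin r), v (i + 1, j + 1) = y i j) {C : Type*} {f : Finset M → C}
    {c : ℕ → C} (hc : ∀ i : Fin s, e ≤ i → IsHomogeneous f r (Set.range (a i)) c)
    {w : Fin (d.m + 1) → ℕ × ℕ} (hw : StrictMono fun k => toLex (w k))
    (hlow : ∀ k, (d.c k).1 ≠ d.iota → w k = d.c k)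
    (hrow : ∃ i : Fin s, e ≤ i ∧
      ∀ k ∈ d.topVars, ∃ j : Fin r, w k = ((i : ℕ) + 1, (j : ℕ) + 1)) :
    ∃ t, f t = c d.topVars.card ∧ d.IsValue y t (d.τ.realize (v ∘ w)) := by
  classical
  obtain ⟨i, hi, hrow⟩ := hrow
  have hmono := strictMonoOn_topVars (ha i) (hv i) hw hrow
  refine ⟨d.topVars.image (v ∘ w), (hc i hi).apply_image hmono.injOn fun k hk => ?_,
    isValue_realize hde hvy hmono hlow Finset.coe_image.symm⟩
  obtain ⟨j, hj⟩ := hrow k hk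
  exact ⟨j, by rw [Function.comp_apply, hj, hv]⟩

/-- The two sides of the equation in the sentence are values of the term for the sets of entries
that it takes from the rows `ι` and `u`; these sets have the same colour, hence the same values. -/
theorem satisfiesAt_sentence_of_isHomogeneous
    (hlt : ∀ a b : M, FirstOrder.Language.Structure.RelMap (relSymbol L lt) ![a, b] ↔ a < b)
    (hes : e < s) (hde : d.iota = e + 1)
    (hocc : ∀ c ∈ constantsIn (d.sentence lt), (1 ≤ c.1 ∧ c.1 ≤ s) ∧ (1 ≤ c.2 ∧ c.2 ≤ r))
    {a : Fin s → Fin r → M} (ha : ∀ i, StrictMono (a i))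
    (hy : ∀ (i : Fin e) (j : Fin r), a (i.castLE hes.le) j = y i j) {C : Type*} {f : Finset M → C}
    (hf : ∀ t t', f t = f t' → ∀ i j, ∀ b < y i j, d.IsValue y t b → d.IsValue y t' b)
    {c : ℕ → C} (hc : ∀ i : Fin s, e ≤ i → IsHomogeneous f r (Set.range (a i)) c) :
    SatisfiesAt (d.sentence lt) a := by
  rw [satisfiesAt_sentence_iff hlt]
  intro v hv hb
  have hvy (i : Fin e) (j : Fin r) : v (i + 1, j + 1) = y i j :=
    (hv (i.castLE hes.le) j).trans (hy i j)
  have hvar {k} (hk : k ∈ d.τ.varFinset) := d.mem_constantsIn_sentence (lt := lt) hk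
  have htop {k} (hk : k ∈ d.topVars) := d.mem_topVars.1 hk
  obtain ⟨t, hcolour_t, hvalue_t⟩ := exists_isValue_of_isHomogeneous hde ha hv hvy hc
    d.c_increasing (fun _ _ => rfl) <| exists_row hes (hde ▸ Nat.lt_succ_self e)
      (fun k hk => (htop hk).2) fun k hk => hocc _ (hvar (htop hk).1).1
  obtain ⟨t', hcolour_t', hvalue_t'⟩ := exists_isValue_of_isHomogeneous hde ha hv hvy hc
    d.right_increasing (fun _ h => if_neg h) <| exists_row hes (hde ▸ d.le_u : e + 1 ≤ d.u)
      (fun k hk => congrArg Prod.fst (if_pos (htop hk).2)) fun k hk => hocc _ (hvar (htop hk).1).2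
  obtain ⟨hbound_row, hbound_col⟩ := hocc _ d.bound_mem_constantsIn_sentence
  rw [hde, Nat.add_sub_cancel] at hb hbound_row
  obtain ⟨i, hi⟩ := exists_eq_fin_add_one ⟨hbound_row.1, le_refl e⟩
  obtain ⟨j, hj⟩ := exists_eq_fin_add_one hbound_col
  have hby : d.τ.realize (v ∘ d.c) < y i j := by rwa [← hvy, ← hi, ← hj]
  have hvalue := hf t t' (hcolour_t.trans hcolour_t'.symm) i j _ hby hvalue_t
  exact hvalue.unique (fun k hk hktop =>
    exists_eq_of_notMem_topVars hde hk hktop (hocc _ (hvar hk).1)) hvalue_t'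

end Value

end TypeIVData

section Model

variable {M : Type w} [LinearOrder M] {θ : Cardinal.{w}} {r s e : ℕ}

theorem mk_set_pattern_lt (hθ : θ.IsInaccessible) {ι D B : Type w} (hι : #ι < θ) (hD : #D < θ)
    (hB : #B < θ) (m n : ℕ) : #(Set (ι × (Fin m → Fin n → D) × B)) < θ := by
  have hpower {E : Type w} (hE : #E < θ) (n : ℕ) : #(Fin n → E) < θ := by
    rw [mk_arrow]
    simpa using power_lt_of_isStrongLimit hθ.isStrongLimit hE (hθ.nat_lt n)
  have hmatrix : #(Fin m → Fin n → D) < θ := hpower (hpower hD n) m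
  have hmatrixB : #((Fin m → Fin n → D) × B) < θ := by
    simpa using mul_lt_of_lt hθ.isRegular.aleph0_le hmatrix hB
  rw [mk_set]
  exact hθ.isStrongLimit.isStrongPrelimit
    (by simpa using mul_lt_of_lt hθ.isRegular.aleph0_le hι hmatrixB)

/-- A finite set `t` is coloured by all triples of a sentence, interpretations of its constants in
the rows below `ι`, and an element `b` below one of these, such that `b` is the value of the term
of the sentence for `t`. -/
theorem isColourDetermined_satisfiesAt {L : FirstOrder.Language.{u, u}} {lt : L.Relations 2}
    [(skolemLanguage L).Structure M]
    (hlt : ∀ a b : M, FirstOrder.Language.Structure.RelMap (relSymbol L lt) ![a, b] ↔ a < b)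
    (hθ : θ.IsInaccessible) (hM : ∀ a : M, #(Set.Iio a) < θ) (hes : e < s)
    {S : Set (Fin s → Fin r → M)} (hS : ∀ a ∈ S, ∀ i, StrictMono (a i)) {ι : Type w} (hι : #ι < θ)
    {σ : ι → CSentence L} (hσ : ∀ k, IsTypeIV lt (σ k) (e + 1))
    (hocc : ∀ k, ∀ c ∈ constantsIn (σ k), (1 ≤ c.1 ∧ c.1 ≤ s) ∧ (1 ≤ c.2 ∧ c.2 ≤ r)) :
    IsColourDetermined θ S {a ∈ S | ∀ k, SatisfiesAt (σ k) a} e := by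
  intro X hX
  choose d hd hde using hσ
  let D : Set M := ⋃ k : ULift.{w} (Fin e), X k.down
  have hD : #D < θ := (card_iUnion_lt_iff_forall_of_isRegular hθ.isRegular
    (by simpa using hθ.nat_lt e)).2 fun k => hX k.down
  let B : Set M := ⋃ a ∈ D, Set.Iio a
  have hB : #B < θ := (card_biUnion_lt_iff_forall_of_isRegular hθ.isRegular hD).2 fun a _ => hM a
  refine ⟨Set (ι × (Fin e → Fin r → D) × B),
    fun t => {q | (d q.1).IsValue (fun i j => (q.2.1 i j : M)) t q.2.2},
    mk_set_pattern_lt hθ hι hD hB e r, fun c a haS hlow hc => ⟨haS, fun k => ?_⟩⟩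
  let y (i : Fin e) (j : Fin r) : D :=
    ⟨a (i.castLE hes.le) j, Set.mem_iUnion.2 ⟨⟨i⟩, hlow (i.castLE hes.le) i.2 j⟩⟩
  rw [← hd k]
  refine (d k).satisfiesAt_sentence_of_isHomogeneous hlt hes (hde k) (hd k ▸ hocc k) (hS a haS)
    (y := fun i j => (y i j : M)) (fun _ _ => rfl) (fun t t' htt' i j b hb hvalue => ?_) hc
  have hbB : b ∈ B := Set.mem_iUnion₂.2 ⟨_, (y i j).2, hb⟩
  exact (Set.ext_iff.1 htt' (k, y, ⟨b, hbB⟩)).1 hvalue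

end Model

end Superlarge

theorem proposition3p4_general {L : FirstOrder.Language.{u, u}} (lt : L.Relations 2)
    {M : Type w} [LinearOrder M] [(Superlarge.skolemLanguage L).Structure M]
    (hlt : ∀ a b : M, FirstOrder.Language.Structure.RelMap
      (Superlarge.relSymbol L lt) ![a, b] ↔ a < b)
    {θ : Cardinal.{w}} (hθ : θ.IsInaccessible) (hM : ∀ a : M, #(Set.Iio a) < θ)
    {F : M → Ordinal.{w}} (hF : Monotone F) {r s e e' : ℕ} (hee' : e < e') (he's : e' ≤ s)
    (S : Set (Fin s → Fin r → M)) (hS : Superlarge.IsSuperlarge θ F S e)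
    {ι : Type w} (hι : #ι < θ) (σ : ι → Superlarge.CSentence L)
    (hσ : ∀ k, Superlarge.IsTypeIV lt (σ k) e')
    (hocc : ∀ k, ∀ c ∈ Superlarge.constantsIn (σ k), (1 ≤ c.1 ∧ c.1 ≤ s) ∧ (1 ≤ c.2 ∧ c.2 ≤ r)) :
    ∃ S' ⊆ S, Superlarge.IsSuperlarge θ F S' e' ∧
      ∀ a ∈ S', ∀ k, Superlarge.SatisfiesAt (σ k) a := by
  obtain ⟨n, rfl⟩ := Nat.exists_eq_succ_of_ne_zero hee'.ne_bot
  have hfibre : ∀ β < θ.ord, #(F ⁻¹' {β}) < θ := fun _ => hS.mk_fibre_lt hθ hM hF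
  have hSn : Superlarge.IsSuperlarge θ F S n :=
    hS.of_le hθ hfibre (Nat.le_of_lt_succ hee') (Nat.le_of_succ_le he's)
  have hcolour : Superlarge.IsColourDetermined θ S
      {a ∈ S | ∀ k, Superlarge.SatisfiesAt (σ k) a} n :=
    Superlarge.isColourDetermined_satisfiesAt hlt hθ hM he's
      (fun a ha i => ((hS.subset ha).1 i).1) hι hσ hocc
  exact ⟨_, Set.sep_subset _ _, hSn.of_isColourDetermined hθ hfibre he's (Set.sep_subset _ _)
    hcolour, fun a ha => ha.2⟩

theorem proposition3p4
    {L : FirstOrder.Language.{u, u}} (hL : L.card ≤ ℵ₀) (lt : L.Relations 2)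
    {M : Type w} [LinearOrder M] [(Superlarge.skolemLanguage L).Structure M]
    (hlt : ∀ a b : M, FirstOrder.Language.Structure.RelMap
      (Superlarge.relSymbol L lt) ![a, b] ↔ a < b)
    (hskolem : FirstOrder.Language.Theory.Model M (Superlarge.skolemTheory L))
    {θ : Cardinal.{w}} (hθ : θ.IsInaccessible) (hM : Superlarge.IsThetaLike θ M)
    (N : Ordinal.{w} → (Superlarge.skolemLanguage L).ElementarySubstructure M)
    (hN : Superlarge.IsElementaryEndChain θ N)
    {r s e e' p : ℕ} (hr : 1 ≤ r) (hes : e < s) (hee' : e < e') (he's : e' ≤ s)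
    (S : Set (Fin s → Fin r → M))
    (hS : Superlarge.IsSuperlarge θ (Superlarge.rankFn θ N) S e)
    (σ : Fin p → Superlarge.CSentence L)
    (hσ : ∀ k, Superlarge.IsTypeIV lt (σ k) e')
    (hocc : ∀ k, ∀ c ∈ Superlarge.constantsIn (σ k), (1 ≤ c.1 ∧ c.1 ≤ s) ∧ (1 ≤ c.2 ∧ c.2 ≤ r)) :
    ∃ S' ⊆ S, Superlarge.IsSuperlarge θ (Superlarge.rankFn θ N) S' e' ∧
      ∀ a ∈ S', ∀ k, Superlarge.SatisfiesAt (σ k) a := by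
  simpa only [ULift.forall] using proposition3p4_general lt hlt hθ hM.2 hN.monotone_rankFn hee'
    he's S hS (ι := ULift.{w} (Fin p)) (by simpa using hθ.nat_lt p) (fun k => σ k.down)
    (fun k => hσ k.down) fun k => hocc k.down
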